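/- **Theorem 1.5.** Let $R$ be a commutative ring and let $Y=(y_{i,j})$ be a skew-symmetric matrix over $R$ (that is, $y_{j,i}=-y_{i,j}$ for all $i,j$). For a $2r\times 2r$ skew-symmetric matrix $A=(a_{i,j})$ put $$\operatorname{Pf}A=\sum_{\pi}\operatorname{sgn}(\pi)\,a_{\pi(1),\pi(2)}a_{\pi(3),\pi(4)}\cdots a_{\pi(2r-1),\pi(2r)},$$ where $\pi$ runs over the permutations of $\{1,\dots,2r\}$ with $\pi(1)<\pi(3)<\dots<\pi(2r-1)$ and $\pi(2i-1)<\pi(2i)$ for $1\le i\le r$ (so $\operatorname{Pf}$ of the empty matrix is $1$). For a finite sequence $L=(k_1,\dots,k_p)$ of row/column indices of $Y$ (repetitions allowed) let $Y(L)=(y_{k_a,k_b})_{1\le a,b\le p}$. Write $\sqcup$ for concatenation of sequences, and for $J=(j_1,\dots,j_m)$ let $J\setminus(j_\beta)$ and $J\setminus(j_\alpha,j_\beta)$ denote $J$ with the terms at position $\beta$, respectively at positions $\alpha$ and $\beta$, removed. Let $l,m,n$ be nonnegative integers of the same parity, and let $I=(i_1,\dots,i_l)$, $J=(j_1,\dots,j_m)$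 and $K$ be sequences of row/column indices of $Y$ of lengths $l$, $m$ and $n$. Let $\tilde Y=(\tilde y_{\alpha,\beta})$ be the $(l+m)\times(l+m)$ skew-symmetric matrix with zero diagonal whose entries above the diagonal are $$\begin{cases}\tilde y_{\alpha,\beta}=\operatorname{Pf}Y((i_\alpha,i_\beta)\sqcup J\sqcup K)&\text{if }1\le\alpha<\beta\le l,\\ \tilde y_{\alpha,l+\beta}=\operatorname{Pf}Y((i_\alpha)\sqcup(J\setminus(j_\beta))\sqcup K)&\text{if }1\le\alpha\le l,\ 1\le\beta\le m,\\ \tilde y_{l+\alpha,l+\beta}=\operatorname{Pf}Y((J\setminus(j_\alpha,j_\beta))\sqcup K)&\text{if }1\le\alpha<\beta\le m.\end{cases}$$ Then $$\operatorname{Pf}\tilde Y=\operatorname{Pf}Y(I\sqcup K)\cdot\bigl(\operatorname{Pf}Y(J\sqcup K)\bigr)^{(l+m)/2-1},$$ whenever the right-hand side is defined, that is, if $l+m>0$ or if $\operatorname{Pf}Y(J\sqcup K)$ is invertible in $R$ (for $l=m=0$ the exponent is $-1$). -/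

import Mathlib

open scoped Matrix

/-- The set `F_n` of permutations `π` of `{0, …, n-1}` (with `n` even) such that
`π 0 < π 2 < π 4 < ⋯` and `π (2 i) < π (2 i + 1)` for all `i < n / 2`
(indices are counted from `0`).  They represent the perfect matchings of `{0, …, n-1}`. -/
def pfaffianPerms (n : ℕ) : Finset (Equiv.Perm (Fin n)) :=
  Finset.univ.filter fun π =>
    (∀ i j : Fin (n / 2), i < j →
      π ⟨2 * (i : ℕ), by omega⟩ < π ⟨2 * (j : ℕ), by omega⟩) ∧
    (∀ i : Fin (n / 2),
      π ⟨2 * (i : ℕ), by omega⟩ < π ⟨2 * (i : ℕ) + 1, by omega⟩)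

/-- The Pfaffian of an `n × n` skew-symmetric matrix, as the signed sum over `pfaffianPerms n`;
it is `1` for `n = 0`, and by convention `0` for odd `n`. -/
def pfaffian {R : Type*} [CommRing R] {n : ℕ} (A : Matrix (Fin n) (Fin n) R) : R :=
  if Even n then
    ∑ π ∈ pfaffianPerms n, ((Equiv.Perm.sign π : ℤ) : R) *
      ∏ i : Fin (n / 2),
        A (π ⟨2 * (i : ℕ), by omega⟩) (π ⟨2 * (i : ℕ) + 1, by omega⟩)
  else 0

/-- `Pf Y(L)`: the Pfaffian of the matrix `Y(L) = (Y (L a) (L b))` obtained from `Y` by picking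
the rows and the columns indexed by the sequence `L` (repetitions are allowed). -/
def pfaffianOn {R ι : Type*} [CommRing R] (Y : Matrix ι ι R) (L : List ι) : R :=
  pfaffian (Y.submatrix L.get L.get)

/-- The entries of `Ỹ` above the diagonal, with the index set `{1, …, l + m}` seen as the
disjoint union of the positions of `I` and those of `J`.  Concatenation is `++`, and removing the
entry at position `β` is `List.eraseIdx · β`; in the last block this is used for `α < β` only, so
that removing first position `β` and then position `α` removes `j_α` and `j_β`.
The block `(inr, inl)` lies below the diagonal and is never used. -/
def sylvesterUpper {R ι : Type*} [CommRing R] (Y : Matrix ι ι R) (I J K : List ι) :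
    Fin I.length ⊕ Fin J.length → Fin I.length ⊕ Fin J.length → R
  | Sum.inl α, Sum.inl β => pfaffianOn Y ([I.get α, I.get β] ++ J ++ K)
  | Sum.inl α, Sum.inr β => pfaffianOn Y ([I.get α] ++ J.eraseIdx β ++ K)
  | Sum.inr α, Sum.inr β => pfaffianOn Y ((J.eraseIdx β).eraseIdx α ++ K)
  | Sum.inr _, Sum.inl _ => 0

/-- The `(l + m) × (l + m)` skew-symmetric matrix `Ỹ` with the entries `sylvesterUpper` above the
diagonal. -/
def sylvesterMatrix {R ι : Type*} [CommRing R] (Y : Matrix ι ι R) (I J K : List ι) :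
    Matrix (Fin (I.length + J.length)) (Fin (I.length + J.length)) R :=
  Matrix.of fun a b =>
    if a < b then sylvesterUpper Y I J K (finSumFinEquiv.symm a) (finSumFinEquiv.symm b)
    else if b < a then -sylvesterUpper Y I J K (finSumFinEquiv.symm b) (finSumFinEquiv.symm a)
    else 0

open CliffordAlgebra (contractLeft contractLeft_ι_mul)
open ExteriorAlgebra (exteriorPower)

/-! ### The Pfaffian as a functional on the exterior algebra. -/

section PfaffianForm

variable {R M : Type*} [CommRing R] [AddCommGroup M] [Module R M]

/-! For an alternating form `B`, the Pfaffian of the matrix `B vᵢ vⱼ` is a linear functional of `v₁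
∧ ⋯ ∧ vₙ`, characterised by the value 1 at 1 and by first-row expansion: multiplying by `a` on the
left amounts to contracting with `B a`.

Fix a word `L`. Tanner's identity `pfaffianForm_mul_pfaffianForm` says that contracting with the new
form `(a, b) ↦ Pf (a, b, L)` replaces left multiplication by `a`, at the cost of a factor `Pf L`.
Peeling off one letter at a time, the Pfaffian of the new form on a product `x` of degree `2k + 2`
is `Pf (x L) * (Pf L) ^ k` (`pfaffianForm_pfaffianBilin`).

The theorem is the case `L = J ⊔ K`. Deletions from `J` become insertions: adjoin for each position
`β` of `J` a dual letter that pairs only with that position, with value `(-1) ^ β`. Expanding along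
a dual letter then deletes `j_β` with sign `+1`. So `Ỹ` is the matrix of the new form on the letters
of `I` followed by the dual letters (`sylvesterUpper_eq`), and in `Pf (x L)` the dual letters cancel
all of `J`, leaving `Pf Y(I ⊔ K)` (`pfaffianForm_rowLetters_mul`). -/

/-- The product in the exterior algebra of a list of vectors. -/
def wedge (R : Type*) {M : Type*} [CommRing R] [AddCommGroup M] [Module R M] (L : List M) :
    ExteriorAlgebra R M :=
  (L.map (ExteriorAlgebra.ι R)).prod

@[simp] theorem wedge_nil : wedge R ([] : List M) = 1 := rfl

@[simp] theorem wedge_cons (a : M) (L : List M) :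
    wedge R (a :: L) = ExteriorAlgebra.ι R a * wedge R L := by
  simp [wedge]

theorem wedge_append (L L' : List M) : wedge R (L ++ L') = wedge R L * wedge R L' := by
  simp [wedge]

/-- Changing the form by `-B` therefore maps the exterior algebra to itself. The sign makes `B`, not
`-B`, appear in the row expansion. -/
theorem LinearMap.BilinForm.IsAlt.toQuadraticMap_neg {B : LinearMap.BilinForm R M}
    (hB : B.IsAlt) : (-B).toQuadraticMap = (0 : QuadraticForm R M) - 0 := by
  ext x
  simp [hB x]

/-- The linear functional on the exterior algebra sending `v₁ ∧ ⋯ ∧ vₙ` to the Pfaffian of the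
matrix `B vᵢ vⱼ`. -/
noncomputable def pfaffianForm (B : LinearMap.BilinForm R M) (hB : B.IsAlt) :
    ExteriorAlgebra R M →ₗ[R] R :=
  ExteriorAlgebra.algebraMapInv.toLinearMap ∘ₗ
    CliffordAlgebra.changeForm hB.toQuadraticMap_neg

variable {B : LinearMap.BilinForm R M} (hB : B.IsAlt)

@[simp] theorem pfaffianForm_one : pfaffianForm B hB 1 = 1 := by
  simp only [pfaffianForm, LinearMap.comp_apply]
  erw [CliffordAlgebra.changeForm_one]
  simp

/-- After the change of form, `a * x` becomes a multiple of `a`, which has no constant term, plus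
the contraction of `x` with `B a`. -/
theorem pfaffianForm_ι_mul (a : M) (x : ExteriorAlgebra R M) :
    pfaffianForm B hB (ExteriorAlgebra.ι R a * x) = pfaffianForm B hB (contractLeft (B a) x) := by
  simp only [pfaffianForm, LinearMap.comp_apply]
  erw [CliffordAlgebra.changeForm_ι_mul, CliffordAlgebra.changeForm_contractLeft]
  have h0 : ExteriorAlgebra.algebraMapInv (R := R) (ExteriorAlgebra.ι R a) = 0 := by
    simp [ExteriorAlgebra.algebraMapInv]
  have hm : ∀ y : ExteriorAlgebra R M,
      ExteriorAlgebra.algebraMapInv (R := R) (ExteriorAlgebra.ι R a * y) = 0 := fun y => by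
    rw [map_mul, h0, zero_mul]
  have hc : ∀ y : ExteriorAlgebra R M, contractLeft ((-B) a) y = -contractLeft (B a) y :=
    fun y => by simp
  erw [AlgHom.toLinearMap_apply, map_sub, hm, hc]
  simp

theorem ι_mul_swap (a b : M) (x : ExteriorAlgebra R M) :
    ExteriorAlgebra.ι R a * (ExteriorAlgebra.ι R b * x) =
      -(ExteriorAlgebra.ι R b * (ExteriorAlgebra.ι R a * x)) := by
  rw [← mul_assoc, ← mul_assoc, eq_neg_iff_add_eq_zero, ← add_mul,
    ExteriorAlgebra.ι_add_mul_swap, zero_mul]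

theorem ι_mul_self_mul (a : M) (x : ExteriorAlgebra R M) :
    ExteriorAlgebra.ι R a * (ExteriorAlgebra.ι R a * x) = 0 := by
  rw [← mul_assoc, ExteriorAlgebra.ι_sq_zero, zero_mul]

/-- The letter `a` anticommutes with all letters, so it slides through `x` until it meets `w`. -/
theorem ι_mul_mul_eq_zero {a : M} {w : ExteriorAlgebra R M}
    (h : ExteriorAlgebra.ι R a * w = 0) (x : ExteriorAlgebra R M) :
    ExteriorAlgebra.ι R a * (x * w) = 0 := by
  induction x using CliffordAlgebra.left_induction with
  | algebraMap r =>
    rw [show algebraMap R (CliffordAlgebra (0 : QuadraticForm R M)) r * w = r • w from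
      (Algebra.smul_def r w).symm, mul_smul_comm, h, smul_zero]
  | add x y hx hy => rw [add_mul, mul_add, hx, hy, add_zero]
  | ι_mul x m hx =>
    have := ι_mul_swap a m (x * w)
    rw [hx, mul_zero, neg_zero] at this
    rw [mul_assoc]
    exact this

theorem ι_mul_wedge_of_mem {a : M} {L : List M} (h : a ∈ L) :
    ExteriorAlgebra.ι R a * wedge R L = 0 := by
  induction L with
  | nil => simp at h
  | cons b L ih =>
    rw [wedge_cons]
    rcases List.mem_cons.1 h with rfl | h
    · exact ι_mul_self_mul _ _
    · rw [ι_mul_swap, ih h, mul_zero, neg_zero]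

theorem contractLeft_wedge_eq_zero {d : Module.Dual R M} {L : List M} (h : ∀ a ∈ L, d a = 0) :
    contractLeft d (wedge R L) = 0 := by
  induction L with
  | nil => exact CliffordAlgebra.contractLeft_one _ _
  | cons b L ih =>
    rw [wedge_cons]
    erw [contractLeft_ι_mul]
    rw [h b (by simp), ih fun a ha => h a (by simp [ha])]
    simp

theorem contractLeft_mul_of_eq_zero {d : Module.Dual R M} {w : ExteriorAlgebra R M}
    (h : contractLeft d w = 0) (x : ExteriorAlgebra R M) :
    contractLeft d (x * w) = contractLeft d x * w := by
  induction x using CliffordAlgebra.left_induction with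
  | algebraMap r =>
    rw [CliffordAlgebra.contractLeft_algebraMap]
    erw [CliffordAlgebra.contractLeft_algebraMap_mul]
    rw [h, mul_zero, zero_mul]
  | add x y hx hy => rw [add_mul, map_add, map_add, add_mul, hx, hy]
  | ι_mul x m hx =>
    rw [mul_assoc]
    erw [contractLeft_ι_mul, contractLeft_ι_mul]
    rw [hx, sub_mul, mul_assoc, smul_mul_assoc]

theorem contractLeft_wedge_mul {d : Module.Dual R M} {L : List M} (h : ∀ a ∈ L, d a = 0)
    (y : ExteriorAlgebra R M) :
    contractLeft d (wedge R L * y) = (-1) ^ L.length * (wedge R L * contractLeft d y) := by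
  induction L with
  | nil => simp
  | cons b L ih =>
    rw [wedge_cons, mul_assoc]
    erw [contractLeft_ι_mul]
    rw [h b (by simp), ih fun a ha => h a (by simp [ha]), zero_smul, List.length_cons, pow_succ,
      zero_sub, mul_assoc, mul_assoc]
    rcases neg_one_pow_eq_or (ExteriorAlgebra R M) L.length with e | e <;> rw [e] <;> simp

theorem ι_mul_wedge_mul (a : M) (L : List M) (y : ExteriorAlgebra R M) :
    ExteriorAlgebra.ι R a * (wedge R L * y) =
      (-1) ^ L.length * (wedge R L * (ExteriorAlgebra.ι R a * y)) := by
  induction L with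
  | nil => simp
  | cons b L ih =>
    rw [wedge_cons, mul_assoc, ι_mul_swap, ih, List.length_cons, pow_succ]
    rcases neg_one_pow_eq_or (ExteriorAlgebra R M) L.length with e | e <;>
      rw [e] <;> simp [mul_assoc]

/-- Expansion of a Pfaffian along an inner letter orthogonal to all letters on its left. -/
theorem pfaffianForm_wedge_mul_ι_mul {a : M} {L : List M} (h : ∀ b ∈ L, B a b = 0)
    (y : ExteriorAlgebra R M) :
    pfaffianForm B hB (wedge R L * (ExteriorAlgebra.ι R a * y)) =
      pfaffianForm B hB (wedge R L * contractLeft (B a) y) := by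
  -- Moving `a` to the front and moving the contraction past `L` both cost `(-1) ^ L.length`.
  have h1 := ι_mul_wedge_mul a L y
  have h2 := contractLeft_wedge_mul h y
  have h3 := pfaffianForm_ι_mul hB a (wedge R L * y)
  rw [h1, h2] at h3
  rcases neg_one_pow_eq_or (ExteriorAlgebra R M) L.length with e | e <;> rw [e] at h3 <;>
    simpa using h3

/-- Contraction deletes one letter at a time, so `c` is the signed sum of the letters weighted by
`φ` of the remaining word. That `c` lies in the span of `L` is what makes it die against `wedge R L`
later. -/
theorem exists_mem_span_contractLeft_wedge (φ : ExteriorAlgebra R M →ₗ[R] R) (L : List M) :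
    ∃ c ∈ Submodule.span R {a | a ∈ L}, ∀ d : Module.Dual R M,
      φ (contractLeft d (wedge R L)) = d c := by
  induction L generalizing φ with
  | nil => exact ⟨0, zero_mem _, fun d => by
      rw [wedge_nil]; erw [CliffordAlgebra.contractLeft_one]; simp⟩
  | cons a L ih =>
    obtain ⟨c, hc, h⟩ := ih (φ ∘ₗ LinearMap.mulLeft R (ExteriorAlgebra.ι R a))
    refine ⟨φ (wedge R L) • a - c, sub_mem (Submodule.smul_mem _ _ (Submodule.subset_span
      (by simp))) (Submodule.span_mono (fun x hx => by simp [Set.mem_ofPred.1 hx]) hc), fun d => ?_⟩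
    rw [wedge_cons]
    erw [contractLeft_ι_mul]
    rw [map_sub, map_sub, map_smul, map_smul, ← h d]
    simp [mul_comm]

/-! ### Overlapping Pfaffians. -/

/-- The alternating bilinear form `(a, b) ↦ Pf (a, b, L)`. -/
noncomputable def pfaffianBilin (L : List M) : LinearMap.BilinForm R M :=
  LinearMap.mk₂ R (fun a b => pfaffianForm B hB
      (ExteriorAlgebra.ι R a * (ExteriorAlgebra.ι R b * wedge R L)))
    (fun _ _ _ => by rw [map_add, add_mul, map_add])
    (fun _ _ _ => by rw [map_smul, smul_mul_assoc, map_smul])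
    (fun _ _ _ => by rw [map_add, add_mul, mul_add, map_add])
    (fun _ _ _ => by rw [map_smul, smul_mul_assoc, mul_smul_comm, map_smul])

theorem pfaffianBilin_apply (L : List M) (a b : M) : pfaffianBilin hB L a b =
    pfaffianForm B hB (ExteriorAlgebra.ι R a * (ExteriorAlgebra.ι R b * wedge R L)) := rfl

theorem pfaffianBilin_isAlt (L : List M) : (pfaffianBilin hB L).IsAlt := fun a => by
  rw [pfaffianBilin_apply, ι_mul_self_mul, map_zero]

/-- Tanner's identity for overlapping Pfaffians. -/
theorem pfaffianForm_mul_pfaffianForm (L : List M) (a : M) (x : ExteriorAlgebra R M) :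
    pfaffianForm B hB (wedge R L) * pfaffianForm B hB (ExteriorAlgebra.ι R a * (x * wedge R L)) =
      pfaffianForm B hB (contractLeft (pfaffianBilin hB L a) x * wedge R L) := by
  obtain ⟨c, hc, h⟩ := exists_mem_span_contractLeft_wedge
    (pfaffianForm B hB ∘ₗ LinearMap.mulLeft R (ExteriorAlgebra.ι R a)) L
  -- Expanding `Pf (b, a, L)` along `b` pairs `b` with this vector, so the new form at `a` is `B
  -- c'`. Modulo the span of `L`, `c'` is `Pf L` times `a`.
  set c' : M := pfaffianForm B hB (wedge R L) • a - c with hc'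
  have hd : pfaffianBilin hB L a = B c' := by
    ext b
    have hs : pfaffianForm B hB (contractLeft (B b) (ExteriorAlgebra.ι R a * wedge R L)) =
        B b c' := by
      erw [contractLeft_ι_mul]
      rw [hc', map_sub, map_sub, map_smul, map_smul, ← h]
      simp [mul_comm]
    rw [pfaffianBilin_apply, ι_mul_swap, map_neg, pfaffianForm_ι_mul, hs, hB.neg_eq]
  -- A repeated letter gives `Pf (a, b, L) = 0` for `b` in `L`, so the contraction acts on `x`
  -- alone.
  have hz : contractLeft (pfaffianBilin hB L a) (wedge R L) = 0 :=
    contractLeft_wedge_eq_zero fun b hb => by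
      rw [pfaffianBilin_apply, ι_mul_wedge_of_mem hb, mul_zero, map_zero]
  have hk : ExteriorAlgebra.ι R c * (x * wedge R L) = 0 := by
    refine ι_mul_mul_eq_zero ?_ x
    refine Submodule.span_induction (p := fun c _ => ExteriorAlgebra.ι R c * wedge R L = 0)
      (fun b hb => ι_mul_wedge_of_mem hb) (by simp) (fun b b' _ _ hb hb' => ?_)
      (fun r b _ hb => ?_) hc
    · rw [map_add, add_mul, hb, hb', add_zero]
    · rw [map_smul, smul_mul_assoc, hb, smul_zero]
  rw [← contractLeft_mul_of_eq_zero hz, hd, ← pfaffianForm_ι_mul, hc', map_sub, sub_mul, hk,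
    sub_zero, map_smul, smul_mul_assoc, map_smul, smul_eq_mul]

theorem contractLeft_mem_exteriorPower (d : Module.Dual R M) {n : ℕ} {x : ExteriorAlgebra R M}
    (hx : x ∈ ⋀[R]^(n + 1) M) : contractLeft d x ∈ ⋀[R]^n M := by
  induction n generalizing x with
  | zero =>
    rw [zero_add, exteriorPower, pow_one] at hx
    obtain ⟨a, rfl⟩ := hx
    erw [CliffordAlgebra.contractLeft_ι]
    rw [exteriorPower, pow_zero]
    exact Submodule.algebraMap_mem _
  | succ n ih =>
    rw [exteriorPower, pow_succ'] at hx
    refine Submodule.mul_induction_on hx ?_ fun x y hx hy => ?_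
    · rintro _ ⟨a, rfl⟩ y hy
      erw [contractLeft_ι_mul]
      refine sub_mem (Submodule.smul_mem _ _ hy) ?_
      have := Submodule.mul_mem_mul (LinearMap.mem_range_self (ExteriorAlgebra.ι R) a) (ih hy)
      rw [exteriorPower, pow_succ']
      exact this
    · rw [map_add]
      exact add_mem hx hy

/-- The Pfaffian of the matrix of the `Pf (a, b, L)`. -/
theorem pfaffianForm_pfaffianBilin (L : List M) (k : ℕ) {x : ExteriorAlgebra R M}
    (hx : x ∈ ⋀[R]^(2 * k + 2) M) :
    pfaffianForm (pfaffianBilin hB L) (pfaffianBilin_isAlt hB L) x =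
      pfaffianForm B hB (x * wedge R L) * pfaffianForm B hB (wedge R L) ^ k := by
  induction k generalizing x with
  | zero =>
    rw [exteriorPower, mul_zero, zero_add, pow_two] at hx
    refine Submodule.mul_induction_on hx ?_ fun x y hx hy => ?_
    · rintro _ ⟨a, rfl⟩ _ ⟨b, rfl⟩
      rw [pfaffianForm_ι_mul]
      erw [CliffordAlgebra.contractLeft_ι]
      rw [Algebra.algebraMap_eq_smul_one, map_smul]
      erw [pfaffianForm_one]
      rw [pfaffianBilin_apply, mul_assoc]
      simp
    · rw [map_add, hx, hy, add_mul, map_add, add_mul]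
  | succ k ih =>
    rw [exteriorPower, pow_succ'] at hx
    refine Submodule.mul_induction_on hx ?_ fun x y hx hy => ?_
    · rintro _ ⟨a, rfl⟩ x hx
      rw [pfaffianForm_ι_mul, ih (contractLeft_mem_exteriorPower _ hx),
        ← pfaffianForm_mul_pfaffianForm, mul_assoc (ExteriorAlgebra.ι R a), pow_succ]
      ring
    · rw [map_add, hx, hy, add_mul, map_add, add_mul]

end PfaffianForm

/-! ### Recursion on perfect matchings. -/

theorem mem_pfaffianPerms {n : ℕ} {π : Equiv.Perm (Fin n)} :
    π ∈ pfaffianPerms n ↔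
      (∀ i j : ℕ, ∀ h : 2 * j + 1 < n, ∀ hij : i < j,
        π ⟨2 * i, by omega⟩ < π ⟨2 * j, by omega⟩) ∧
      (∀ i : ℕ, ∀ h : 2 * i + 1 < n, π ⟨2 * i, by omega⟩ < π ⟨2 * i + 1, h⟩) := by
  rw [pfaffianPerms, Finset.mem_filter]
  constructor
  · rintro ⟨-, h1, h2⟩
    exact ⟨fun i j h hij => h1 ⟨i, by omega⟩ ⟨j, by omega⟩ hij, fun i h => h2 ⟨i, by omega⟩⟩
  · rintro ⟨h1, h2⟩
    exact ⟨Finset.mem_univ _, fun i j hij => h1 i j (by omega) hij, fun i => h2 i (by omega)⟩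

theorem Fin.prod_univ_of_eq_succ {R : Type*} [CommMonoid R] {a b : ℕ} (h : a = b + 1)
    (f : Fin a → R) :
    ∏ i, f i = f ⟨0, by omega⟩ * ∏ i : Fin b, f ⟨i + 1, by omega⟩ := by
  subst h
  rw [Fin.prod_univ_succ]
  rfl

/-- The permutation of `{0, …, n + 1}` fixing `0`, sending `1` to `j + 1`, and permuting the other
points in the order pattern of `σ`. -/
def pairWithZero {n : ℕ} (j : Fin (n + 1)) (σ : Equiv.Perm (Fin n)) :
    Equiv.Perm (Fin (n + 2)) :=
  Equiv.Perm.decomposeFin.symm (0, j.cycleRange.symm * Equiv.Perm.decomposeFin.symm (0, σ))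

section pairWithZero

variable {n : ℕ} (j : Fin (n + 1)) (σ : Equiv.Perm (Fin n))

theorem pairWithZero_zero : pairWithZero j σ 0 = 0 := by
  simp [pairWithZero]

theorem pairWithZero_succ_zero : pairWithZero j σ (Fin.succ 0) = j.succ := by
  simp only [pairWithZero, Equiv.Perm.decomposeFin_symm_apply_succ, Equiv.swap_self]
  simp [Fin.cycleRange_symm_zero]

theorem pairWithZero_succ_succ (k : Fin n) :
    pairWithZero j σ k.succ.succ = (j.succAbove (σ k)).succ := by
  simp only [pairWithZero, Equiv.Perm.decomposeFin_symm_apply_succ, Equiv.swap_self,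
    Equiv.Perm.coe_mul, Function.comp_apply, Equiv.refl_apply, Fin.cycleRange_symm_succ]

theorem sign_pairWithZero :
    Equiv.Perm.sign (pairWithZero j σ) = (-1) ^ (j : ℕ) * Equiv.Perm.sign σ := by
  simp [pairWithZero, Equiv.Perm.decomposeFin.symm_sign, Fin.sign_cycleRange]

theorem pairWithZero_injective :
    Function.Injective fun p : Fin (n + 1) × Equiv.Perm (Fin n) => pairWithZero p.1 p.2 := by
  rintro ⟨j, σ⟩ ⟨j', σ'⟩ h
  have hj : j = j' := by
    have := DFunLike.congr_fun h (Fin.succ 0)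
    simpa only [pairWithZero_succ_zero, Fin.succ_inj] using this
  subst hj
  simpa [pairWithZero] using h

theorem exists_pairWithZero {π : Equiv.Perm (Fin (n + 2))} (h : π 0 = 0) :
    ∃ j σ, pairWithZero j σ = π := by
  obtain ⟨⟨p, τ⟩, rfl⟩ := Equiv.Perm.decomposeFin.symm.surjective π
  rw [Equiv.Perm.decomposeFin_symm_apply_zero] at h
  subst h
  obtain ⟨⟨q, σ⟩, hq⟩ := Equiv.Perm.decomposeFin.symm.surjective ((τ 0).cycleRange * τ)
  have : q = 0 := by
    have := DFunLike.congr_fun hq 0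
    rw [Equiv.Perm.decomposeFin_symm_apply_zero] at this
    simpa using this
  subst this
  refine ⟨τ 0, σ, ?_⟩
  rw [pairWithZero, hq]
  congr 2
  ext x
  simp

theorem pairWithZero_mem_pfaffianPerms :
    pairWithZero j σ ∈ pfaffianPerms (n + 2) ↔ σ ∈ pfaffianPerms n := by
  have e : ∀ k (hk : k + 2 < n + 2), pairWithZero j σ ⟨k + 2, hk⟩ =
      (j.succAbove (σ ⟨k, by omega⟩)).succ := fun k hk => pairWithZero_succ_succ j σ ⟨k, by omega⟩
  rw [mem_pfaffianPerms, mem_pfaffianPerms]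
  constructor
  · rintro ⟨h1, h2⟩
    constructor
    · intro i k h hik
      have := h1 (i + 1) (k + 1) (by omega) (by omega)
      simp only [Nat.mul_add, mul_one] at this
      rwa [e, e, Fin.succ_lt_succ_iff, Fin.succAbove_lt_succAbove_iff] at this
    · intro i h
      have := h2 (i + 1) (by omega)
      simp only [Nat.mul_add, mul_one, Nat.add_right_comm _ 2 1] at this
      rwa [e, e, Fin.succ_lt_succ_iff, Fin.succAbove_lt_succAbove_iff] at this
  · rintro ⟨h1, h2⟩
    constructor
    · intro i k h hik
      obtain ⟨k, rfl⟩ : ∃ k', k = k' + 1 := ⟨k - 1, by omega⟩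
      simp only [Nat.mul_add, mul_one]
      rw [e]
      rcases i with _ | i
      · exact (pairWithZero_zero j σ).trans_lt (Fin.succ_pos _)
      · simp only [Nat.mul_add, mul_one]
        rw [e, Fin.succ_lt_succ_iff, Fin.succAbove_lt_succAbove_iff]
        exact h1 i k (by omega) (by omega)
    · intro i h
      rcases i with _ | i
      · exact (pairWithZero_zero j σ).trans_lt
          ((Fin.succ_pos _).trans_eq (pairWithZero_succ_zero j σ).symm)
      · simp only [Nat.mul_add, mul_one, Nat.add_right_comm _ 2 1]
        rw [e, e, Fin.succ_lt_succ_iff, Fin.succAbove_lt_succAbove_iff]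
        exact h2 i (by omega)

end pairWithZero

/-- Every position belongs to a pair since `n` is even; first members increase and second members
exceed their partners, so `π 0` is the least value. -/
theorem apply_zero_of_mem_pfaffianPerms {n : ℕ} (hn : Even n) {π : Equiv.Perm (Fin (n + 2))}
    (h : π ∈ pfaffianPerms (n + 2)) : π 0 = 0 := by
  rw [mem_pfaffianPerms] at h
  obtain ⟨h1, h2⟩ := h
  obtain ⟨m, hm⟩ := hn
  have key : ∀ x, π 0 ≤ π x := by
    have h0 : ∀ i (hi : 2 * i + 1 < n + 2), π 0 ≤ π ⟨2 * i, by omega⟩ := fun i hi => by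
      rcases i with _ | i
      · exact le_rfl
      · exact (h1 0 (i + 1) hi (by omega)).le
    rintro ⟨x, hx⟩
    obtain ⟨i, rfl | rfl⟩ := Nat.even_or_odd' x
    · exact h0 i (by omega)
    · exact (h0 i hx).trans (h2 i hx).le
  simpa using key (π.symm 0)

/-! ### First-row expansion and comparison with the functional. -/

section

variable {R : Type*} [CommRing R]

theorem pfaffian_of_odd {n : ℕ} (hn : ¬ Even n) (A : Matrix (Fin n) (Fin n) R) :
    pfaffian A = 0 := if_neg hn

theorem pfaffian_fin_zero (A : Matrix (Fin 0) (Fin 0) R) : pfaffian A = 1 := by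
  rw [pfaffian, if_pos (by simp)]
  have : pfaffianPerms 0 = {1} := by decide
  rw [this]
  simp

/-- Expansion of the Pfaffian along the first row. -/
theorem pfaffian_succ_succ {n : ℕ} (A : Matrix (Fin (n + 2)) (Fin (n + 2)) R) :
    pfaffian A = ∑ j : Fin (n + 1), (-1) ^ (j : ℕ) * A 0 j.succ *
      pfaffian (A.submatrix (fun k => (j.succAbove k).succ) fun k => (j.succAbove k).succ) := by
  by_cases hn : Even n
  swap
  · rw [pfaffian_of_odd (by simpa [Nat.even_add] using hn)]
    simp [pfaffian_of_odd hn]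
  simp only [pfaffian, if_pos hn, if_pos (show Even (n + 2) by simpa [Nat.even_add] using hn),
    Finset.mul_sum]
  rw [← Finset.sum_product']
  symm
  refine Finset.sum_nbij (fun p => pairWithZero p.1 p.2) ?_ pairWithZero_injective.injOn ?_ ?_
  · rintro ⟨j, σ⟩ h
    exact (pairWithZero_mem_pfaffianPerms j σ).2 (Finset.mem_product.1 h).2
  · intro π hπ
    obtain ⟨j, σ, rfl⟩ := exists_pairWithZero (apply_zero_of_mem_pfaffianPerms hn hπ)
    exact ⟨(j, σ), by simpa using (pairWithZero_mem_pfaffianPerms j σ).1 hπ, rfl⟩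
  · rintro ⟨j, σ⟩ -
    rw [Fin.prod_univ_of_eq_succ (show (n + 2) / 2 = n / 2 + 1 by omega), sign_pairWithZero]
    have e0 : A (pairWithZero j σ ⟨2 * 0, by omega⟩) (pairWithZero j σ ⟨2 * 0 + 1, by omega⟩) =
        A 0 j.succ :=
      congrArg₂ A (pairWithZero_zero j σ) (pairWithZero_succ_zero j σ)
    have e1 : ∀ i : Fin (n / 2), A (pairWithZero j σ ⟨2 * (i + 1), by omega⟩)
        (pairWithZero j σ ⟨2 * (i + 1) + 1, by omega⟩) =
        A (j.succAbove (σ ⟨2 * i, by omega⟩)).succ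
          (j.succAbove (σ ⟨2 * i + 1, by omega⟩)).succ := fun i =>
      congrArg₂ A (pairWithZero_succ_succ j σ ⟨2 * i, by omega⟩)
        (pairWithZero_succ_succ j σ ⟨2 * i + 1, by omega⟩)
    simp only [e0, e1, Matrix.submatrix_apply]
    push_cast
    ring

variable {M : Type*} [AddCommGroup M] [Module R M]

theorem contractLeft_wedge_ofFn (d : Module.Dual R M) {n : ℕ} (v : Fin (n + 1) → M) :
    CliffordAlgebra.contractLeft d (wedge R (List.ofFn v)) =
      ∑ j : Fin (n + 1), ((-1) ^ (j : ℕ) * d (v j)) •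
        wedge R (List.ofFn fun k => v (j.succAbove k)) := by
  induction n with
  | zero =>
    simp only [List.ofFn_succ, List.ofFn_zero, wedge_cons, wedge_nil]
    rw [mul_one]
    erw [CliffordAlgebra.contractLeft_ι]
    simp [Algebra.algebraMap_eq_smul_one]
  | succ n ih =>
    rw [List.ofFn_succ, wedge_cons]
    erw [CliffordAlgebra.contractLeft_ι_mul]
    rw [ih, Fin.sum_univ_succ (n := n + 1), sub_eq_add_neg, Finset.mul_sum, ← Finset.sum_neg_distrib]
    congr 1
    · simp
    · refine Finset.sum_congr rfl fun j _ => ?_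
      rw [List.ofFn_succ (f := fun k => v (j.succ.succAbove k)), wedge_cons, mul_smul_comm]
      simp [pow_succ]

/-- The Pfaffian as a linear functional on the exterior algebra. -/
theorem pfaffian_eq_pfaffianForm {B : LinearMap.BilinForm R M} (hB : B.IsAlt) {n : ℕ}
    (A : Matrix (Fin n) (Fin n) R) (v : Fin n → M)
    (h : ∀ i j, i < j → A i j = B (v i) (v j)) :
    pfaffian A = pfaffianForm B hB (wedge R (List.ofFn v)) := by
  -- Both sides obey the same first-row expansion, which only reads entries above the diagonal.
  induction n using Nat.twoStepInduction with
  | zero => rw [pfaffian_fin_zero]; simp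
  | one =>
    rw [pfaffian_of_odd (by simp), List.ofFn_succ, wedge_cons, pfaffianForm_ι_mul, List.ofFn_zero,
      wedge_nil]
    erw [CliffordAlgebra.contractLeft_one]
    simp
  | more n ih _ =>
    rw [pfaffian_succ_succ, List.ofFn_succ, wedge_cons, pfaffianForm_ι_mul,
      contractLeft_wedge_ofFn, map_sum]
    refine Finset.sum_congr rfl fun j _ => ?_
    rw [map_smul, smul_eq_mul, h 0 j.succ (Fin.succ_pos j)]
    congr 1
    exact ih _ _ fun a b hab => h _ _
      (Fin.succ_lt_succ_iff.2 (Fin.succAbove_lt_succAbove_iff.2 hab))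

end

section

variable {R : Type*} [CommRing R]

theorem Matrix.toBilin'_isAlt {σ : Type*} [Fintype σ] [DecidableEq σ] {Z : Matrix σ σ R}
    (h : ∀ p q, Z q p = -Z p q) (h0 : ∀ p, Z p p = 0) : (Matrix.toBilin' Z).IsAlt := fun x => by
  rw [Matrix.toBilin'_apply, ← Finset.sum_product']
  refine Finset.sum_involution (fun p _ => (p.2, p.1)) ?_ ?_ (by simp) (by simp)
  · rintro ⟨p, q⟩ -
    simp only [h p q]
    ring
  · rintro ⟨p, q⟩ - hpq e
    obtain rfl : q = p := (Prod.ext_iff.1 e).1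
    simp [h0] at hpq

theorem wedge_mem_exteriorPower {M : Type*} [AddCommGroup M] [Module R M] (L : List M) :
    wedge R L ∈ ⋀[R]^L.length M := by
  induction L with
  | nil => exact Submodule.one_le.1 (by simp [exteriorPower])
  | cons a L ih =>
    rw [wedge_cons, List.length_cons, exteriorPower, pow_succ']
    exact Submodule.mul_mem_mul (LinearMap.mem_range_self _ a) ih

theorem contractLeft_wedge_eq_eraseIdx {M : Type*} [AddCommGroup M] [Module R M]
    (d : Module.Dual R M) (L : List M) (i : ℕ) (hi : i < L.length)
    (h : ∀ k (hk : k < L.length), k ≠ i → d L[k] = 0) :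
    contractLeft d (wedge R L) = ((-1) ^ i * d L[i]) • wedge R (L.eraseIdx i) := by
  induction L generalizing i with
  | nil => simp at hi
  | cons b L ih =>
    rw [wedge_cons]
    erw [contractLeft_ι_mul]
    rcases i with _ | i
    · have hz : ∀ a ∈ L, d a = 0 := fun a ha => by
        obtain ⟨k, hk, rfl⟩ := List.getElem_of_mem ha
        exact h (k + 1) (by simpa using hk) (by simp)
      rw [contractLeft_wedge_eq_zero hz]
      simp
    · have h0 : d b = 0 := h 0 (by simp) (by simp)
      rw [h0, ih i (by simpa using hi) fun k hk hki =>
        h (k + 1) (by simpa using hk) (by simpa using hki)]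
      simp [pow_succ]

end

/-! ### Dual letters and Sylvester's identity. -/

namespace SylvesterPfaffian

variable {R ι : Type*} [CommRing R]

/-- The positions of three concatenated sequences. -/
abbrev Pos (l m n : ℕ) := Fin l ⊕ Fin m ⊕ Fin n

/-- The positions of three sequences, with a dual letter for each position of the second one. -/
abbrev Letter (l m n : ℕ) := Pos l m n ⊕ Fin m

section Positions

variable (l m n : ℕ)

/-- The positions of the first sequence. -/
def posI : List (Pos l m n) := (List.finRange l).map Sum.inl

/-- The positions of the second sequence. -/
def posJ : List (Pos l m n) := (List.finRange m).map (Sum.inr ∘ Sum.inl)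

/-- The positions of the third sequence. -/
def posK : List (Pos l m n) := (List.finRange n).map (Sum.inr ∘ Sum.inr)

theorem length_posJ : (posJ l m n).length = m := by simp [posJ]

theorem nodup_posI : (posI l m n).Nodup :=
  (List.nodup_finRange l).map Sum.inl_injective

theorem nodup_posJ : (posJ l m n).Nodup :=
  (List.nodup_finRange m).map (Sum.inr_injective.comp Sum.inl_injective)

theorem nodup_posK : (posK l m n).Nodup :=
  (List.nodup_finRange n).map (Sum.inr_injective.comp Sum.inr_injective)

theorem nodup_posI_append_posK : (posI l m n ++ posK l m n).Nodup :=
  (nodup_posI l m n).append (nodup_posK l m n) (by simp [posI, posK, List.Disjoint])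

theorem nodup_posJ_append_posK : (posJ l m n ++ posK l m n).Nodup :=
  (nodup_posJ l m n).append (nodup_posK l m n) (by simp [posJ, posK, List.Disjoint])

theorem inl_notMem (α : Fin l) : Sum.inl α ∉ posJ l m n ++ posK l m n := by
  simp [posJ, posK]

end Positions

variable (Y : Matrix ι ι R) (I J K : List ι)

/-- The term at a position. -/
def term : Pos I.length J.length K.length → ι :=
  Sum.elim I.get (Sum.elim J.get K.get)

theorem map_term_posI : (posI I.length J.length K.length).map (term I J K) = I := by
  rw [posI, List.map_map]
  exact List.map_get_finRange I

theorem map_term_posJ : (posJ I.length J.length K.length).map (term I J K) = J := by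
  rw [posJ, List.map_map]
  exact List.map_get_finRange J

theorem map_term_posK : (posK I.length J.length K.length).map (term I J K) = K := by
  rw [posK, List.map_map]
  exact List.map_get_finRange K

/-- The alternating matrix on letters: the entries of `Y` between distinct positions, and
`(-1) ^ β` between the dual letter `β` and the position `β` of `J`. -/
def letterMatrix : Matrix (Letter I.length J.length K.length) (Letter I.length J.length K.length) R
  | .inl p, .inl q => if p = q then 0 else Y (term I J K p) (term I J K q)
  | .inr β, .inl q => if q = .inr (.inl β) then (-1) ^ (β : ℕ) else 0
  | .inl p, .inr β => if p = .inr (.inl β) then -(-1) ^ (β : ℕ) else 0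
  | .inr _, .inr _ => 0

/-- The bilinear form of `letterMatrix`. -/
noncomputable def letterForm :
    LinearMap.BilinForm R (Letter I.length J.length K.length → R) :=
  Matrix.toBilin' (letterMatrix Y I J K)

-- Skew-symmetry of `Y` gives only `2 * Y a a = 0`, so the diagonal is made zero by hand. Working
-- with positions confines this to equal positions: repeated indices at distinct positions keep
-- their entry of `Y`.
variable {Y} in
theorem letterForm_isAlt (hY : Yᵀ = -Y) : (letterForm Y I J K).IsAlt := by
  have hY' : ∀ a b, Y b a = -Y a b := fun a b => congrFun (congrFun hY a) b
  refine Matrix.toBilin'_isAlt ?_ ?_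
  · rintro (p | p) (q | q) <;> simp only [letterMatrix, neg_zero]
    · split_ifs with h1 h2 h2
      · simp
      · exact absurd h1.symm h2
      · exact absurd h2.symm h1
      · exact hY' _ _
    · split_ifs <;> simp
    · split_ifs <;> simp
  · rintro (p | p) <;> simp [letterMatrix]

/-- The vector of a letter. -/
abbrev vec (R : Type*) [CommRing R] {l m n : ℕ} (p : Letter l m n) : Letter l m n → R :=
  Pi.single p 1

theorem letterForm_vec (p q) :
    letterForm Y I J K (vec R p) (vec R q) = letterMatrix Y I J K p q :=
  Matrix.toBilin'_single _ _ _

/-- The product of the vectors of a sequence of positions. -/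
noncomputable def posWedge (R : Type*) [CommRing R] {l m n : ℕ} (P : List (Pos l m n)) :
    ExteriorAlgebra R (Letter l m n → R) :=
  wedge R (P.map fun p => vec R (.inl p))

theorem posWedge_append {l m n : ℕ} (P Q : List (Pos l m n)) :
    posWedge R (P ++ Q) = posWedge R P * posWedge R Q := by
  rw [posWedge, List.map_append, wedge_append]; rfl

theorem posWedge_cons {l m n : ℕ} (p : Pos l m n) (Q : List (Pos l m n)) :
    posWedge R (p :: Q) = ExteriorAlgebra.ι R (vec R (.inl p)) * posWedge R Q := by
  rw [posWedge, List.map_cons, wedge_cons]; rfl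

variable {Y} (hY : Yᵀ = -Y)

theorem pfaffianForm_posWedge {P : List (Pos I.length J.length K.length)} (hP : P.Nodup) :
    pfaffianForm (letterForm Y I J K) (letterForm_isAlt I J K hY) (posWedge R P) =
      pfaffianOn Y (P.map (term I J K)) := by
  rw [pfaffianOn, pfaffian_eq_pfaffianForm (letterForm_isAlt I J K hY) _
    fun i => vec R (.inl (P.get (i.cast (by simp))))]
  · rw [posWedge]
    congr 2
    apply List.ext_getElem <;> simp
  · intro i j hij
    rw [letterForm_vec]
    simp only [letterMatrix]
    rw [if_neg]
    · simp
    · rw [hP.get_inj_iff]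
      simpa [Fin.ext_iff] using hij.ne

/-- Only position `β` of `J` pairs with the dual letter; the sign `(-1) ^ β` of its place in `P`
cancels the entry `(-1) ^ β`. Hence it must still stand at place `β` when it is removed. -/
theorem contractLeft_dual_posWedge {P : List (Pos I.length J.length K.length)} (hP : P.Nodup)
    (β : Fin J.length) (h : ∃ hβ : β < P.length, P[(β : ℕ)]'hβ = .inr (.inl β)) :
    contractLeft (letterForm Y I J K (vec R (.inr β))) (posWedge R P) =
      posWedge R (P.eraseIdx β) := by
  obtain ⟨hβ, h⟩ := h
  rw [posWedge, contractLeft_wedge_eq_eraseIdx _ _ β (by simpa using hβ)]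
  · rw [List.getElem_map, letterForm_vec, h, List.eraseIdx_map]
    simp [letterMatrix, posWedge, ← pow_add, ← two_mul]
  · intro k hk hkβ
    rw [List.getElem_map, letterForm_vec]
    simp only [letterMatrix]
    rw [if_neg]
    rw [← h, hP.getElem_inj_iff]
    exact hkβ

theorem letterForm_dual_inl (β : Fin J.length) (α : Fin I.length) :
    letterForm Y I J K (vec R (.inr β)) (vec R (.inl (.inl α))) = 0 := by
  rw [letterForm_vec]
  simp [letterMatrix]

theorem letterForm_dual_dual (β γ : Fin J.length) :
    letterForm Y I J K (vec R (.inr β)) (vec R (.inr γ)) = 0 := by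
  rw [letterForm_vec]
  rfl

theorem getElem_posJ_append (β : Fin J.length) (T : List (Pos I.length J.length K.length)) :
    ∃ hβ : β < (posJ I.length J.length K.length ++ T).length,
      (posJ I.length J.length K.length ++ T)[(β : ℕ)]'hβ = .inr (.inl β) := by
  refine ⟨by simp [length_posJ]; omega, ?_⟩
  rw [List.getElem_append_left (by simp [length_posJ])]
  simp [posJ]

/-- The letters indexing the rows of the matrix in Sylvester's identity. -/
def rowLetter {l m n : ℕ} : Fin l ⊕ Fin m → Letter l m n :=
  Sum.elim (fun α => .inl (.inl α)) .inr

/-- Each dual letter is orthogonal to the row letters on its left, so expanding along it merely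
erases its partner in `J`. -/
theorem sylvesterUpper_eq (a b : Fin (I.length + J.length)) (hab : a < b) :
    sylvesterUpper Y I J K (finSumFinEquiv.symm a) (finSumFinEquiv.symm b) =
      pfaffianBilin (letterForm_isAlt I J K hY)
        ((posJ I.length J.length K.length ++ posK I.length J.length K.length).map
          fun p => vec R (.inl p))
        (vec R (rowLetter (finSumFinEquiv.symm a))) (vec R (rowLetter (finSumFinEquiv.symm b))) := by
  obtain ⟨a, rfl⟩ := finSumFinEquiv.surjective a
  obtain ⟨b, rfl⟩ := finSumFinEquiv.surjective b
  rw [Equiv.symm_apply_apply, Equiv.symm_apply_apply, pfaffianBilin_apply, ← posWedge]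
  have hJK := nodup_posJ_append_posK I.length J.length K.length
  have hlen := length_posJ I.length J.length K.length
  have hcontr := fun β => contractLeft_dual_posWedge (Y := Y) I J K hJK β
    (getElem_posJ_append I J K β _)
  have herase : ∀ β : Fin J.length,
      (posJ I.length J.length K.length ++ posK I.length J.length K.length).eraseIdx β =
        (posJ I.length J.length K.length).eraseIdx β ++ posK I.length J.length K.length :=
    fun β => List.eraseIdx_append_of_lt_length (by omega) _
  rcases a with α | α <;> rcases b with β | β
  · have hαβ : α ≠ β := by
      rintro rfl
      exact lt_irrefl _ hab
    simp only [rowLetter, Sum.elim_inl]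
    rw [← posWedge_cons, ← posWedge_cons, pfaffianForm_posWedge I J K hY]
    · simp only [List.map_cons, List.map_append, map_term_posJ, map_term_posK]
      rfl
    · rw [List.nodup_cons, List.nodup_cons]
      refine ⟨?_, inl_notMem _ _ _ β, hJK⟩
      rw [List.mem_cons, not_or]
      exact ⟨by simpa using hαβ, inl_notMem _ _ _ α⟩
  · simp only [rowLetter, Sum.elim_inl, Sum.elim_inr]
    have := pfaffianForm_wedge_mul_ι_mul (letterForm_isAlt I J K hY) (a := vec R (.inr β))
      (L := [vec R (.inl (.inl α))]) (by simp [letterForm_dual_inl])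
      (posWedge R (posJ I.length J.length K.length ++ posK I.length J.length K.length))
    rw [wedge_cons, wedge_nil, mul_one] at this
    rw [this, hcontr, ← posWedge_cons, pfaffianForm_posWedge I J K hY]
    · rw [herase, List.map_cons, List.map_append, ← List.eraseIdx_map, map_term_posJ, map_term_posK]
      rfl
    · exact List.nodup_cons.2 ⟨fun h => inl_notMem _ _ _ α (List.mem_of_mem_eraseIdx h),
        hJK.eraseIdx _⟩
  · exfalso
    simp [Fin.lt_def] at hab
    omega
  · simp only [rowLetter, Sum.elim_inr]
    have hαβ : (α : ℕ) < β := by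
      rw [finSumFinEquiv_apply_right, finSumFinEquiv_apply_right, Fin.lt_def] at hab
      simp only [Fin.val_natAdd] at hab
      omega
    have := pfaffianForm_wedge_mul_ι_mul (letterForm_isAlt I J K hY) (a := vec R (.inr β))
      (L := [vec R (.inr α)])
      (fun b hb => by rw [List.mem_singleton.1 hb, letterForm_dual_dual])
      (posWedge R (posJ I.length J.length K.length ++ posK I.length J.length K.length))
    rw [wedge_cons, wedge_nil, mul_one] at this
    rw [this, hcontr, pfaffianForm_ι_mul, contractLeft_dual_posWedge I J K (hJK.eraseIdx _) α,
      pfaffianForm_posWedge I J K hY ((hJK.eraseIdx _).eraseIdx _), herase,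
      List.eraseIdx_append_of_lt_length (by rw [List.length_eraseIdx]; split_ifs <;> omega),
      List.map_append, ← List.eraseIdx_map, ← List.eraseIdx_map, map_term_posJ, map_term_posK]
    · rfl
    · obtain ⟨h1, h2⟩ := getElem_posJ_append I J K α (posK I.length J.length K.length)
      refine ⟨by rw [List.length_eraseIdx, List.length_append]; split_ifs <;> omega, ?_⟩
      -- Removing the later position `β` first leaves position `α` at place `α`.
      rw [List.getElem_eraseIdx_of_lt _ hαβ]
      exact h2

theorem pfaffianForm_rowLetters_mul :
    pfaffianForm (letterForm Y I J K) (letterForm_isAlt I J K hY)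
      (posWedge R (posI I.length J.length K.length) *
        wedge R ((List.finRange J.length).map fun β => vec R (.inr β)) *
        posWedge R (posJ I.length J.length K.length ++ posK I.length J.length K.length)) =
      pfaffianOn Y (I ++ K) := by
  have hlen := length_posJ I.length J.length K.length
  -- Truncate both the dual letters and `J` to their first `p` terms. Expanding along the last dual
  -- letter removes the last remaining term of `J`, so the value does not depend on `p`; at `p = 0`
  -- only `I` and `K` remain.
  have key : ∀ p ≤ J.length, pfaffianForm (letterForm Y I J K) (letterForm_isAlt I J K hY)
      (wedge R ((posI I.length J.length K.length).map (fun p => vec R (.inl p)) ++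
        ((List.finRange J.length).take p).map fun β => vec R (.inr β)) *
        posWedge R ((posJ I.length J.length K.length).take p ++
          posK I.length J.length K.length)) = pfaffianOn Y (I ++ K) := by
    intro p
    induction p with
    | zero =>
      intro _
      have := pfaffianForm_posWedge I J K hY
        (nodup_posI_append_posK I.length J.length K.length)
      rw [posWedge_append, List.map_append, map_term_posI, map_term_posK] at this
      simpa [posWedge] using this
    | succ p ih =>
      intro hp
      rw [← ih (by omega), ← List.take_append_getElem (l := List.finRange J.length)
        (i := p) (by simpa using hp), List.map_append, ← List.append_assoc, wedge_append,
        List.map_singleton, wedge_cons, wedge_nil, mul_one, mul_assoc,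
        pfaffianForm_wedge_mul_ι_mul, contractLeft_dual_posWedge]
      · congr 3
        rw [List.eraseIdx_append_of_lt_length (by simp [hlen]; omega)]
        simp [List.eraseIdx_eq_take_drop_succ, List.take_take]
      · exact (nodup_posJ_append_posK I.length J.length K.length).sublist
          ((List.take_sublist _ _).append_right _)
      · refine ⟨by simp [hlen]; omega, ?_⟩
        rw [List.getElem_append_left (by simp [hlen]; omega)]
        simp [posJ]
      · intro b hb
        rw [List.mem_append] at hb
        rcases hb with hb | hb
        · obtain ⟨q, hq, rfl⟩ := List.mem_map.1 hb
          obtain ⟨α, -, rfl⟩ := List.mem_map.1 hq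
          exact letterForm_dual_inl I J K _ α
        · obtain ⟨γ, -, rfl⟩ := List.mem_map.1 hb
          exact letterForm_dual_dual I J K _ γ
  have := key J.length le_rfl
  rwa [List.take_of_length_le (by simp), List.take_of_length_le hlen.le, wedge_append] at this

theorem wedge_rowLetters (l m n : ℕ) :
    wedge R (List.ofFn fun a : Fin (l + m) =>
      vec R (rowLetter (finSumFinEquiv.symm a) : Letter l m n)) =
      posWedge R (posI l m n) * wedge R ((List.finRange m).map fun β => vec R (.inr β)) := by
  have : (fun a : Fin (l + m) => vec R (rowLetter (finSumFinEquiv.symm a) : Letter l m n)) =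
      Fin.append (fun α => vec R (.inl (.inl α))) fun β => vec R (.inr β) := by
    ext a : 1
    refine Fin.addCases (fun α => ?_) (fun β => ?_) a <;> simp [rowLetter]
  rw [this, List.ofFn_fin_append, wedge_append, List.ofFn_eq_map, List.ofFn_eq_map, posWedge,
    posI, List.map_map]
  rfl

theorem pfaffian_sylvesterMatrix (hY : Yᵀ = -Y) (k : ℕ) (hk : I.length + J.length = 2 * k + 2) :
    pfaffian (sylvesterMatrix Y I J K) =
      pfaffianOn Y (I ++ K) * pfaffianOn Y (J ++ K) ^ k := by
  set L : List (Letter I.length J.length K.length → R) :=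
    (posJ I.length J.length K.length ++ posK I.length J.length K.length).map
      fun p => vec R (.inl p) with hL
  have hmem := wedge_mem_exteriorPower (R := R) (List.ofFn fun a : Fin (I.length + J.length) =>
    vec R (rowLetter (finSumFinEquiv.symm a) : Letter I.length J.length K.length))
  replace hmem := (congrArg (fun N => _ ∈ ⋀[R]^N _) ((List.length_ofFn).trans hk)).mp hmem
  have hent : ∀ a b, a < b → sylvesterMatrix Y I J K a b =
      pfaffianBilin (letterForm_isAlt I J K hY) L (vec R (rowLetter (finSumFinEquiv.symm a)))
        (vec R (rowLetter (finSumFinEquiv.symm b))) := fun a b hab => by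
    rw [← sylvesterUpper_eq I J K hY a b hab, sylvesterMatrix, Matrix.of_apply, if_pos hab]
  rw [pfaffian_eq_pfaffianForm (pfaffianBilin_isAlt (letterForm_isAlt I J K hY) L) _
    (fun a => vec R (rowLetter (finSumFinEquiv.symm a))) hent,
    pfaffianForm_pfaffianBilin _ _ k hmem, wedge_rowLetters, hL, ← posWedge,
    pfaffianForm_rowLetters_mul I J K hY, pfaffianForm_posWedge I J K hY
      (nodup_posJ_append_posK I.length J.length K.length), List.map_append, map_term_posJ,
    map_term_posK]

end SylvesterPfaffian

theorem theorem1p5 {R ι : Type*} [CommRing R] (Y : Matrix ι ι R) (hY : Yᵀ = -Y)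
    (I J K : List ι)
    (hIJ : I.length % 2 = J.length % 2) (hJK : J.length % 2 = K.length % 2) :
    (0 < I.length + J.length →
      pfaffian (sylvesterMatrix Y I J K) =
        pfaffianOn Y (I ++ K) *
          pfaffianOn Y (J ++ K) ^ ((I.length + J.length) / 2 - 1)) ∧
    (∀ u : Rˣ, (u : R) = pfaffianOn Y (J ++ K) →
      pfaffian (sylvesterMatrix Y I J K) =
        pfaffianOn Y (I ++ K) *
          ((u ^ ((((I.length + J.length) / 2 : ℕ) : ℤ) - 1) : Rˣ) : R)) := by
  have hpos : 0 < I.length + J.length →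
      pfaffian (sylvesterMatrix Y I J K) =
        pfaffianOn Y (I ++ K) *
          pfaffianOn Y (J ++ K) ^ ((I.length + J.length) / 2 - 1) := fun h =>
    SylvesterPfaffian.pfaffian_sylvesterMatrix I J K hY _ (by omega)
  refine ⟨hpos, fun u hu => ?_⟩
  rcases Nat.eq_zero_or_pos (I.length + J.length) with h | h
  · obtain rfl : I = [] := List.length_eq_zero_iff.1 (by omega)
    obtain rfl : J = [] := List.length_eq_zero_iff.1 (by omega)
    -- Both Pfaffians on the right are `Pf Y(K) = u`, and `u * u⁻¹ = 1` is the empty Pfaffian.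
    rw [← hu]
    simpa using pfaffian_fin_zero (sylvesterMatrix Y [] [] K)
  · have h1 : 1 ≤ (I.length + J.length) / 2 := by omega
    rw [hpos h, ← hu, ← Nat.cast_pred h1, zpow_natCast, Units.val_pow_eq_pow_val]
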